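/- **Setting.** Let $M\subset\mathbb R^n$ be a compact connected domain with smooth boundary, let $\Gamma\subset\partial M$ be (relatively) open, let $\Omega\subset M$ and $r_0>0$. For a smooth strictly positive function $c$ on $M$ let $g=c^{-2}dx^2$ be the associated isotropic Riemannian metric, $d_g$ the Riemannian distance of $(M,g)$, $\nu$ the inward pointing $g$-unit normal on $\partial M$, and for $y\in\Gamma$ let $s\mapsto\gamma(s;y,\nu)$ be the $g$-geodesic with initial point $y$ and initial velocity $\nu$, considered as long as it stays in $M$. Let $$\sigma_\Gamma(y)=\sup\{s>0:\ \gamma(\cdot;y,\nu)\text{ stays in }M\text{ on }[0,s]\text{ and } d_g(\gamma(s;y,\nu),\Gamma)=s\},$$ and define the semi-geodesic coordinate map $\Phi_g(y,s)=\gamma(s;y,\nu)$ for $y\in\Gamma$, $0\le s<\sigma_\Gamma(y)$. Let $H_c\phi=\phi\circ\Phi_g$ for $\phi\in C^\infty(M)$ with $\Delta\phi=0$ ($\Delta$ the Euclidean Laplacian), and put $$\|H_{\tilde c}-H_c\|_{C^1(M)\to C^1(\Gamma\times[0,r_0))}=\sup\{\|H_{\tilde c}\phi-H_c\phi\|_{C^1(\Gamma\times[0,r_0))}:\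 \phi\in C^\infty(M),\ \Delta\phi=0,\ \|\phi\|_{C^1(M)}\le1\}.$$ **Theorem.** Let $\mathcal G$ be a family of smooth isotropic metrics $\tilde g=\tilde c^{-2}dx^2$ on $M$, $\tilde c>0$, such that for every $\tilde g\in\mathcal G$ the map $\Phi_{\tilde g}$ is defined on $\Gamma\times[0,r_0)$ and $$\overline\Omega\subset\Phi_{\tilde g}(\Gamma\times[0,r_0)).$$ Let $c^{-2}dx^2\in\mathcal G$. Then there are $\epsilon>0$ and $C>0$ such that for every $\tilde c^{-2}dx^2\in\mathcal G$ with $\|\tilde c-c\|_{C^2(M)}\le\epsilon$, $$\|\tilde c^2-c^2\|_{C(\Omega)}\le C\,\|H_{\tilde c}-H_c\|_{C^1(M)\to C^1(\Gamma\times[0,r_0))}.$$ -/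

import Mathlib

open Set
open scoped ContDiff ENNReal

noncomputable section

namespace SemiGeodesic

/-! ### Compact domains with smooth boundary -/

/-- `ρ` is a smooth defining function on the open set `U ∋ p` of the set `M` near its boundary
point `p`: it has non-zero differential at `p` and is non-negative exactly on `M`. -/
structure IsDefiningFunctionAt {n : ℕ} (M : Set (EuclideanSpace ℝ (Fin n)))
    (p : EuclideanSpace ℝ (Fin n)) (U : Set (EuclideanSpace ℝ (Fin n)))
    (ρ : EuclideanSpace ℝ (Fin n) → ℝ) : Prop where
  isOpen : IsOpen U
  mem : p ∈ U
  contDiffOn : ContDiffOn ℝ ∞ ρ U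
  eq_zero : ρ p = 0
  fderiv_ne_zero : fderiv ℝ ρ p ≠ 0
  inter_eq : M ∩ U = {x ∈ U | 0 ≤ ρ x}

/-- Compact connected domains of `ℝⁿ` with smooth boundary. -/
structure IsSmoothCompactDomain {n : ℕ} (M : Set (EuclideanSpace ℝ (Fin n))) : Prop where
  isCompact : IsCompact M
  isConnected : IsConnected M
  smooth_boundary : ∀ p ∈ frontier M, ∃ U ρ, IsDefiningFunctionAt M p U ρ

/-- `f ∈ C^∞(M)`, as restrictions to `M` of smooth functions on `ℝⁿ`. Only the values of `f` on
`M` matter. -/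
def SmoothOn {n : ℕ} (M : Set (EuclideanSpace ℝ (Fin n)))
    (f : EuclideanSpace ℝ (Fin n) → ℝ) : Prop :=
  ∃ F : EuclideanSpace ℝ (Fin n) → ℝ, ContDiff ℝ ∞ F ∧ EqOn f F M

/-! ### Norms, with values in `[0, ∞]` -/

/-- The norm of `C(S)`. -/
def supNorm {X : Type*} (S : Set X) (f : X → ℝ) : ℝ≥0∞ := ⨆ x ∈ S, ‖f x‖ₑ

/-- The norm of the differential at `p` of a function `f` on a subset `S` of a normed space.
A derivative of `f` within `S` at `p` is determined only on the tangent space of `S` at `p`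
(when `S` is a submanifold, possibly with boundary); the norm of the differential as a functional
on that tangent space is the smallest norm of such a derivative. It is `∞` if `f` is not
differentiable at `p` along `S`. -/
def diffNorm {X : Type*} [NormedAddCommGroup X] [NormedSpace ℝ X] (S : Set X) (f : X → ℝ)
    (p : X) : ℝ≥0∞ :=
  ⨅ (L : X →L[ℝ] ℝ) (_ : HasFDerivWithinAt f L S p), ‖L‖ₑ

/-- The norm of `C¹(S)`. -/
def c1Norm {X : Type*} [NormedAddCommGroup X] [NormedSpace ℝ X] (S : Set X) (f : X → ℝ) :
    ℝ≥0∞ :=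
  supNorm S f + ⨆ p ∈ S, diffNorm S f p

/-- The norm of `C²(M)` for a domain `M` of `ℝⁿ`. -/
def c2Norm {n : ℕ} (M : Set (EuclideanSpace ℝ (Fin n))) (f : EuclideanSpace ℝ (Fin n) → ℝ) :
    ℝ≥0∞ :=
  ∑ j ∈ Finset.range 3, ⨆ x ∈ M, ‖iteratedFDerivWithin ℝ j f M x‖ₑ

/-! ### Riemannian geometry in Cartesian coordinates

A Riemannian metric on `M ⊆ ℝⁿ` is given by its matrix `g x` in the Cartesian coordinates. -/

/-- The isotropic metric `c⁻² dx²`. -/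
def isotropicMetric {n : ℕ} (c : EuclideanSpace ℝ (Fin n) → ℝ) :
    EuclideanSpace ℝ (Fin n) → Matrix (Fin n) (Fin n) ℝ :=
  fun x => (c x ^ 2)⁻¹ • (1 : Matrix (Fin n) (Fin n) ℝ)

/-- The inner product `g_x(v, w)`. -/
def metricInner {n : ℕ} (g : EuclideanSpace ℝ (Fin n) → Matrix (Fin n) (Fin n) ℝ)
    (x v w : EuclideanSpace ℝ (Fin n)) : ℝ :=
  ∑ i, ∑ j, g x i j * v i * w j

/-- The partial derivative `∂ g_{ij} / ∂ x^k` on `M` (one-sided at the boundary). -/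
def metricDeriv {n : ℕ} (M : Set (EuclideanSpace ℝ (Fin n)))
    (g : EuclideanSpace ℝ (Fin n) → Matrix (Fin n) (Fin n) ℝ) (i j k : Fin n)
    (x : EuclideanSpace ℝ (Fin n)) : ℝ :=
  fderivWithin ℝ (fun z => g z i j) M x (EuclideanSpace.single k 1)

/-- The Christoffel symbol `Γ^j_{kl}` of `g` on `M`. -/
def christoffel {n : ℕ} (M : Set (EuclideanSpace ℝ (Fin n)))
    (g : EuclideanSpace ℝ (Fin n) → Matrix (Fin n) (Fin n) ℝ) (j k l : Fin n)
    (x : EuclideanSpace ℝ (Fin n)) : ℝ :=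
  (1 / 2) * ∑ m, (g x)⁻¹ j m *
    (metricDeriv M g m k l x + metricDeriv M g m l k x - metricDeriv M g k l m x)

/-- `ν` is the inward pointing unit normal vector of `∂M` at `y` with respect to `g`. The kernel of
the differential of a defining function is the tangent space of `∂M`. -/
def IsInwardUnitNormal {n : ℕ} (M : Set (EuclideanSpace ℝ (Fin n)))
    (g : EuclideanSpace ℝ (Fin n) → Matrix (Fin n) (Fin n) ℝ)
    (y ν : EuclideanSpace ℝ (Fin n)) : Prop :=
  metricInner g y ν ν = 1 ∧ ∃ U ρ, IsDefiningFunctionAt M y U ρ ∧ 0 < fderiv ℝ ρ y ν ∧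
    ∀ w, fderiv ℝ ρ y w = 0 → metricInner g y ν w = 0

/-- `γ`, restricted to `[0, s]`, is the geodesic `γ(·; y, ν)` of `(M, g)` that starts at `y ∈ ∂M`
with the inward unit normal as its initial velocity; in particular it stays in `M` up to the
time `s`. Here `v` is the velocity of `γ`. -/
def IsNormalGeodesic {n : ℕ} (M : Set (EuclideanSpace ℝ (Fin n)))
    (g : EuclideanSpace ℝ (Fin n) → Matrix (Fin n) (Fin n) ℝ)
    (y : EuclideanSpace ℝ (Fin n)) (s : ℝ) (γ : ℝ → EuclideanSpace ℝ (Fin n)) : Prop :=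
  γ 0 = y ∧ MapsTo γ (Icc 0 s) M ∧
    ∃ v : ℝ → EuclideanSpace ℝ (Fin n), IsInwardUnitNormal M g y (v 0) ∧
      ∀ t ∈ Icc 0 s, HasDerivWithinAt γ (v t) (Icc 0 s) t ∧
        HasDerivWithinAt v
          (WithLp.toLp 2 fun j => -∑ k, ∑ l, christoffel M g j k l (γ t) * v t k * v t l)
          (Icc 0 s) t

/-- The length with respect to `g` of a curve `α : [0, 1] → ℝⁿ`. -/
def curveLength {n : ℕ} (g : EuclideanSpace ℝ (Fin n) → Matrix (Fin n) (Fin n) ℝ)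
    (α : ℝ → EuclideanSpace ℝ (Fin n)) : ℝ≥0∞ :=
  ∫⁻ t in Icc (0 : ℝ) 1, ENNReal.ofReal (Real.sqrt
    (metricInner g (α t) (derivWithin α (Icc 0 1) t) (derivWithin α (Icc 0 1) t)))

/-- The Riemannian distance of `(M, g)`: the infimum of the lengths of the `C¹` curves in `M`
between two points (a piecewise `C¹` curve becomes `C¹` when it is reparametrized so as to stop
at its corners). -/
def riemDist {n : ℕ} (M : Set (EuclideanSpace ℝ (Fin n)))
    (g : EuclideanSpace ℝ (Fin n) → Matrix (Fin n) (Fin n) ℝ)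
    (x z : EuclideanSpace ℝ (Fin n)) : ℝ≥0∞ :=
  ⨅ α ∈ {α : ℝ → EuclideanSpace ℝ (Fin n) | ContDiffOn ℝ 1 α (Icc 0 1) ∧
    MapsTo α (Icc 0 1) M ∧ α 0 = x ∧ α 1 = z}, curveLength g α

/-- The distance `d(x, Γ)`. -/
def distTo {n : ℕ} (M : Set (EuclideanSpace ℝ (Fin n)))
    (g : EuclideanSpace ℝ (Fin n) → Matrix (Fin n) (Fin n) ℝ)
    (Γ : Set (EuclideanSpace ℝ (Fin n))) (x : EuclideanSpace ℝ (Fin n)) : ℝ≥0∞ :=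
  ⨅ z ∈ Γ, riemDist M g x z

/-! ### Semi-geodesic coordinates -/

/-- `σ_Γ(y)`: the maximal arc length for which the normal geodesic from `y`, as long as it stays
in `M`, minimizes the distance to `Γ`. -/
def sigma {n : ℕ} (M : Set (EuclideanSpace ℝ (Fin n)))
    (g : EuclideanSpace ℝ (Fin n) → Matrix (Fin n) (Fin n) ℝ)
    (Γ : Set (EuclideanSpace ℝ (Fin n))) (y : EuclideanSpace ℝ (Fin n)) : ℝ≥0∞ :=
  sSup {a : ℝ≥0∞ | ∃ s : ℝ, 0 < s ∧ a = ENNReal.ofReal s ∧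
    ∃ γ, IsNormalGeodesic M g y s γ ∧ distTo M g Γ (γ s) = ENNReal.ofReal s}

/-- The domain `{(y, s) : y ∈ Γ, 0 ≤ s < σ_Γ(y)}` of the semi-geodesic coordinate map. -/
def semiGeodesicDomain {n : ℕ} (M : Set (EuclideanSpace ℝ (Fin n)))
    (g : EuclideanSpace ℝ (Fin n) → Matrix (Fin n) (Fin n) ℝ)
    (Γ : Set (EuclideanSpace ℝ (Fin n))) : Set (EuclideanSpace ℝ (Fin n) × ℝ) :=
  {p | p.1 ∈ Γ ∧ 0 ≤ p.2 ∧ ENNReal.ofReal p.2 < sigma M g Γ p.1}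

open Classical in
/-- The map `Φ_g(y, s) = γ(s; y, ν)`. The geodesic is unique, and it exists on `[0, s]` when
`(y, s)` is in `semiGeodesicDomain M g Γ`; where it does not exist the value is irrelevant. -/
def Phi {n : ℕ} (M : Set (EuclideanSpace ℝ (Fin n)))
    (g : EuclideanSpace ℝ (Fin n) → Matrix (Fin n) (Fin n) ℝ)
    (p : EuclideanSpace ℝ (Fin n) × ℝ) : EuclideanSpace ℝ (Fin n) :=
  if h : ∃ γ, IsNormalGeodesic M g p.1 p.2 γ then h.choose p.2 else p.1

/-- The wave speeds `c`, smooth and strictly positive on `M`, such that for `g = c⁻² dx²` the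
semi-geodesic coordinate map `Φ_g` is defined on `Γ × [0, r₀)` and the image of this set contains
the closure of `Ω`. -/
def admissibleSpeeds {n : ℕ} (M Γ Ω : Set (EuclideanSpace ℝ (Fin n))) (r₀ : ℝ) :
    Set (EuclideanSpace ℝ (Fin n) → ℝ) :=
  {c | SmoothOn M c ∧ (∀ x ∈ M, 0 < c x) ∧
    Γ ×ˢ Ico 0 r₀ ⊆ semiGeodesicDomain M (isotropicMetric c) Γ ∧
    closure Ω ⊆ Phi M (isotropicMetric c) '' (Γ ×ˢ Ico 0 r₀)}

/-- The space `{φ ∈ C^∞(M) : Δφ = 0}` on which the operators `H_c` are defined. -/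
def harmonicFunctions {n : ℕ} (M : Set (EuclideanSpace ℝ (Fin n))) :
    Set (EuclideanSpace ℝ (Fin n) → ℝ) :=
  {φ | SmoothOn M φ ∧ InnerProductSpace.HarmonicOnNhd φ (interior M)}

/-- The operator `H_c φ = φ ∘ Φ_g`, `g = c⁻² dx²`. -/
def H {n : ℕ} (M : Set (EuclideanSpace ℝ (Fin n))) (c φ : EuclideanSpace ℝ (Fin n) → ℝ) :
    EuclideanSpace ℝ (Fin n) × ℝ → ℝ :=
  fun p => φ (Phi M (isotropicMetric c) p)

/-- The norm `‖A‖_{C¹(M) → C¹(S)}` of an operator `A` on the harmonic functions of `C^∞(M)`. -/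
def opNorm {n : ℕ} (M : Set (EuclideanSpace ℝ (Fin n)))
    (S : Set (EuclideanSpace ℝ (Fin n) × ℝ))
    (A : (EuclideanSpace ℝ (Fin n) → ℝ) → (EuclideanSpace ℝ (Fin n) × ℝ → ℝ)) : ℝ≥0∞ :=
  ⨆ φ ∈ {φ ∈ harmonicFunctions M | c1Norm M φ ≤ 1}, c1Norm S (A φ)

end SemiGeodesic

end

namespace SemiGeodesic

open Filter Topology

variable {n : ℕ}

/-! ### Isotropic metrics -/

/-! The wave speed can be read off from the coordinate map. A `g`-unit-speed geodesic of `c⁻² dx²`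
has Euclidean speed `c`, so `‖∂ₛΦ_c(y, s)‖ = c (Φ_c(y, s))` (`exists_hasDerivWithinAt_Phi`). Linear
functions are harmonic; testing `H_{c'} - H_c` on those of norm at most `(R + 1)⁻¹`, with `R` a
bound for `M`, controls both `Φ_{c'} - Φ_c` and `∂ₛΦ_{c'} - ∂ₛΦ_c` by the operator norm
(`mul_norm_sub_le_opNorm`).

For `x = Φ_{c'}(y, s)` in `Ω` and `z = Φ_c(y, s)`, the difference `c' x - c z` is one of Euclidean
speeds, and `c z - c x` is bounded by the Lipschitz constant of `c` times `‖x - z‖`. Multiplying by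
the bounded sum `c' x + c x` gives the estimate for the squares.

Most of the work makes `∂ₛΦ` meaningful: the inward normal and the geodesic must be unique, so that
the choices in `Phi` fit together into one differentiable curve. -/

theorem metricInner_isotropicMetric (c : EuclideanSpace ℝ (Fin n) → ℝ)
    (x v w : EuclideanSpace ℝ (Fin n)) :
    metricInner (isotropicMetric c) x v w = (c x ^ 2)⁻¹ * inner ℝ v w := by
  simp only [metricInner, isotropicMetric, Matrix.smul_apply, Matrix.one_apply, smul_eq_mul,
    mul_ite, mul_one, mul_zero, ite_mul, zero_mul, Finset.sum_ite_eq, Finset.mem_univ, if_true,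
    PiLp.inner_apply, Finset.mul_sum]
  refine Finset.sum_congr rfl fun i _ => ?_
  simp
  ring

theorem metricDeriv_isotropicMetric (M : Set (EuclideanSpace ℝ (Fin n)))
    (c : EuclideanSpace ℝ (Fin n) → ℝ) (i j k : Fin n) (x : EuclideanSpace ℝ (Fin n)) :
    metricDeriv M (isotropicMetric c) i j k x =
      if i = j then fderivWithin ℝ (fun z => (c z ^ 2)⁻¹) M x (EuclideanSpace.single k 1)
      else 0 := by
  by_cases h : i = j
  · simp [metricDeriv, isotropicMetric, h]
  · simp [metricDeriv, isotropicMetric, h]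

theorem inv_isotropicMetric {c : EuclideanSpace ℝ (Fin n) → ℝ} {x : EuclideanSpace ℝ (Fin n)}
    (hx : c x ≠ 0) : (isotropicMetric c x)⁻¹ = (c x ^ 2) • (1 : Matrix (Fin n) (Fin n) ℝ) := by
  refine Matrix.inv_eq_left_inv ?_
  simp [isotropicMetric, smul_smul, hx]

/-- The acceleration of a geodesic of `c⁻² dx²` with velocity `v` at a point where `c` has the
value `r` and `c⁻²` has the differential `D`. -/
noncomputable def acceleration (r : ℝ) (D : EuclideanSpace ℝ (Fin n) →L[ℝ] ℝ)
    (v : EuclideanSpace ℝ (Fin n)) : EuclideanSpace ℝ (Fin n) :=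
  (r ^ 2 / 2) • (‖v‖ ^ 2 • (InnerProductSpace.toDual ℝ (EuclideanSpace ℝ (Fin n))).symm D
    - (2 * D v) • v)

theorem clm_apply_eq_sum (D : EuclideanSpace ℝ (Fin n) →L[ℝ] ℝ)
    (v : EuclideanSpace ℝ (Fin n)) : D v = ∑ i, v i * D (EuclideanSpace.single i 1) := by
  conv_lhs => rw [← (EuclideanSpace.basisFun (Fin n) ℝ).sum_repr v]
  simp

theorem toDual_symm_apply_coord (D : EuclideanSpace ℝ (Fin n) →L[ℝ] ℝ) (j : Fin n) :
    (InnerProductSpace.toDual ℝ (EuclideanSpace ℝ (Fin n))).symm D j =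
      D (EuclideanSpace.single j 1) := by
  have h := InnerProductSpace.toDual_symm_apply (𝕜 := ℝ) (y := D)
    (x := EuclideanSpace.single j 1)
  rw [← h, EuclideanSpace.inner_single_right]
  simp

theorem geodesic_acceleration_isotropicMetric (M : Set (EuclideanSpace ℝ (Fin n)))
    {c : EuclideanSpace ℝ (Fin n) → ℝ} {x : EuclideanSpace ℝ (Fin n)} (hx : c x ≠ 0)
    (v : EuclideanSpace ℝ (Fin n)) :
    (WithLp.toLp 2 fun j => -∑ k, ∑ l, christoffel M (isotropicMetric c) j k l x * v k * v l) =
      acceleration (c x) (fderivWithin ℝ (fun z => (c z ^ 2)⁻¹) M x) v := by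
  ext j
  set D := fderivWithin ℝ (fun z => (c z ^ 2)⁻¹) M x with hD
  have hΓ : ∀ k l, christoffel M (isotropicMetric c) j k l x = c x ^ 2 / 2 *
      ((if j = k then D (EuclideanSpace.single l 1) else 0) +
        (if j = l then D (EuclideanSpace.single k 1) else 0) -
        (if k = l then D (EuclideanSpace.single j 1) else 0)) := by
    intro k l
    simp only [christoffel, inv_isotropicMetric hx, metricDeriv_isotropicMetric, ← hD,
      Matrix.smul_apply, Matrix.one_apply, smul_eq_mul, mul_ite, mul_one, mul_zero, ite_mul,
      zero_mul, Finset.sum_ite_eq, Finset.mem_univ, if_true]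
    ring
  have h1 : ∑ k, ∑ l, (if j = k then D (EuclideanSpace.single l 1) else 0) * v k * v l
      = v j * D v := by
    rw [clm_apply_eq_sum D v]
    simp only [ite_mul, zero_mul, Finset.mul_sum]
    rw [Finset.sum_comm]
    simp only [Finset.sum_ite_eq, Finset.mem_univ, if_true]
    exact Finset.sum_congr rfl fun i _ => by ring
  have h2 : ∑ k, ∑ l, (if j = l then D (EuclideanSpace.single k 1) else 0) * v k * v l
      = v j * D v := by
    rw [clm_apply_eq_sum D v]
    simp only [ite_mul, zero_mul, Finset.mul_sum, Finset.sum_ite_eq, Finset.mem_univ, if_true]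
    exact Finset.sum_congr rfl fun i _ => by ring
  have h3 : ∑ k, ∑ l, (if k = l then D (EuclideanSpace.single j 1) else 0) * v k * v l
      = ‖v‖ ^ 2 * D (EuclideanSpace.single j 1) := by
    simp only [ite_mul, zero_mul, Finset.sum_ite_eq, Finset.mem_univ, if_true,
      EuclideanSpace.real_norm_sq_eq, Finset.sum_mul]
    exact Finset.sum_congr rfl fun i _ => by ring
  have h4 : ∑ k, ∑ l, christoffel M (isotropicMetric c) j k l x * v k * v l =
      c x ^ 2 / 2 * (v j * D v + v j * D v - ‖v‖ ^ 2 * D (EuclideanSpace.single j 1)) := by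
    rw [← h3]
    nth_rewrite 1 [← h1]
    rw [← h2]
    simp only [hΓ, ← Finset.sum_add_distrib, ← Finset.sum_sub_distrib, Finset.mul_sum]
    exact Finset.sum_congr rfl fun k _ => Finset.sum_congr rfl fun l _ => by ring
  simp only [h4, acceleration, PiLp.smul_apply, PiLp.sub_apply, smul_eq_mul,
    toDual_symm_apply_coord]
  ring

/-! ### Smooth boundaries -/

variable {M : Set (EuclideanSpace ℝ (Fin n))}

theorem IsDefiningFunctionAt.tendsto_slope {p : EuclideanSpace ℝ (Fin n)}
    {U : Set (EuclideanSpace ℝ (Fin n))} {ρ : EuclideanSpace ℝ (Fin n) → ℝ}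
    (h : IsDefiningFunctionAt M p U ρ) (w : EuclideanSpace ℝ (Fin n)) :
    Tendsto (fun t : ℝ => t⁻¹ * ρ (p + t • w)) (𝓝[>] 0) (𝓝 (fderiv ℝ ρ p w)) := by
  have hd : HasFDerivAt ρ (fderiv ℝ ρ p) p :=
    ((h.contDiffOn.contDiffAt (h.isOpen.mem_nhds h.mem)).differentiableAt (by simp)).hasFDerivAt
  have hl : HasDerivAt (fun t : ℝ => ρ (p + t • w)) (fderiv ℝ ρ p w) 0 := by
    have h1 : HasDerivAt (fun t : ℝ => p + t • w) w 0 := by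
      simpa using ((hasDerivAt_id (0 : ℝ)).smul_const w).const_add p
    exact HasFDerivAt.comp_hasDerivAt (0 : ℝ) (by simpa using hd) h1
  have := hasDerivAt_iff_tendsto_slope_zero.1 hl
  refine (this.mono_left (nhdsWithin_mono _ fun t ht => ne_of_gt ht)).congr fun t => ?_
  simp [h.eq_zero]

theorem IsDefiningFunctionAt.eventually_mem_nhds {p : EuclideanSpace ℝ (Fin n)}
    {U : Set (EuclideanSpace ℝ (Fin n))} {ρ : EuclideanSpace ℝ (Fin n) → ℝ}
    (h : IsDefiningFunctionAt M p U ρ) (w : EuclideanSpace ℝ (Fin n)) :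
    ∀ᶠ t : ℝ in 𝓝[>] 0, p + t • w ∈ U := by
  have hcont : Tendsto (fun t : ℝ => p + t • w) (𝓝 0) (𝓝 p) := by
    have : Continuous fun t : ℝ => p + t • w := by fun_prop
    simpa using this.tendsto 0
  exact (hcont.mono_left nhdsWithin_le_nhds) (h.isOpen.mem_nhds h.mem)

theorem IsDefiningFunctionAt.eventually_mem {p : EuclideanSpace ℝ (Fin n)}
    {U : Set (EuclideanSpace ℝ (Fin n))} {ρ : EuclideanSpace ℝ (Fin n) → ℝ}
    (h : IsDefiningFunctionAt M p U ρ) {w : EuclideanSpace ℝ (Fin n)}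
    (hw : 0 < fderiv ℝ ρ p w) : ∀ᶠ t : ℝ in 𝓝[>] 0, p + t • w ∈ M := by
  filter_upwards [(h.tendsto_slope w).eventually (lt_mem_nhds hw), h.eventually_mem_nhds w,
    self_mem_nhdsWithin] with t ht htU ht0
  have ht0 : 0 < t := ht0
  have : 0 < ρ (p + t • w) := (pos_iff_pos_of_mul_pos ht).1 (inv_pos.2 ht0)
  have : p + t • w ∈ M ∩ U := by
    rw [h.inter_eq]
    exact ⟨htU, this.le⟩
  exact this.1

theorem IsDefiningFunctionAt.fderiv_nonneg {p : EuclideanSpace ℝ (Fin n)}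
    {U : Set (EuclideanSpace ℝ (Fin n))} {ρ : EuclideanSpace ℝ (Fin n) → ℝ}
    (h : IsDefiningFunctionAt M p U ρ) {w : EuclideanSpace ℝ (Fin n)}
    (hw : ∀ᶠ t : ℝ in 𝓝[>] 0, p + t • w ∈ M) : 0 ≤ fderiv ℝ ρ p w := by
  refine ge_of_tendsto (h.tendsto_slope w) ?_
  filter_upwards [hw, h.eventually_mem_nhds w, self_mem_nhdsWithin] with t ht htU ht0
  have ht0 : 0 < t := ht0
  have : p + t • w ∈ {x ∈ U | 0 ≤ ρ x} := h.inter_eq ▸ ⟨ht, htU⟩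
  exact mul_nonneg (inv_pos.2 ht0).le this.2

/-- The tangent cone contains the open half-space where the differential of `ρ` is positive, and a
half-space spans: adding a large multiple of an inward `w₀` moves any vector into it. -/
theorem IsDefiningFunctionAt.uniqueDiffWithinAt {p : EuclideanSpace ℝ (Fin n)}
    {U : Set (EuclideanSpace ℝ (Fin n))} {ρ : EuclideanSpace ℝ (Fin n) → ℝ}
    (h : IsDefiningFunctionAt M p U ρ) (hp : p ∈ M) : UniqueDiffWithinAt ℝ M p := by
  have hcone : ∀ w, 0 < fderiv ℝ ρ p w → w ∈ tangentConeAt ℝ M p := fun w hw =>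
    mem_tangentConeAt_of_add_smul_mem (c := fun t : ℝ => t) (l := 𝓝[>] (0 : ℝ))
      (tendsto_id.mono_left (nhdsWithin_mono _ fun t ht => ne_of_gt ht)) (h.eventually_mem hw)
  obtain ⟨w₀, hw₀⟩ : ∃ w, fderiv ℝ ρ p w = 1 := by
    obtain ⟨w, hw⟩ := DFunLike.ne_iff.1 h.fderiv_ne_zero
    exact ⟨(fderiv ℝ ρ p w)⁻¹ • w, by simpa using inv_mul_cancel₀ (by simpa using hw)⟩
  refine ⟨?_, subset_closure hp⟩
  have htop : Submodule.span ℝ (tangentConeAt ℝ M p) = ⊤ := by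
    refine (Submodule.eq_top_iff').2 fun z => ?_
    have h1 := Submodule.subset_span (R := ℝ) (hcone w₀ (by simp [hw₀]))
    have h2 := Submodule.subset_span (R := ℝ)
      (hcone (z + (|fderiv ℝ ρ p z| + 1) • w₀)
        (by simp only [map_add, map_smul, hw₀, smul_eq_mul]
            linarith [neg_abs_le (fderiv ℝ ρ p z)]))
    have h3 := Submodule.sub_mem _ h2 (Submodule.smul_mem _ (|fderiv ℝ ρ p z| + 1) h1)
    simpa using h3
  rw [htop]
  exact dense_univ

theorem IsSmoothCompactDomain.uniqueDiffOn (hM : IsSmoothCompactDomain M) :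
    UniqueDiffOn ℝ M := by
  intro p hp
  by_cases hpi : p ∈ interior M
  · exact uniqueDiffWithinAt_of_mem_nhds (mem_interior_iff_mem_nhds.1 hpi)
  · obtain ⟨U, ρ, h⟩ := hM.smooth_boundary p ⟨subset_closure hp, hpi⟩
    exact h.uniqueDiffWithinAt hp

theorem IsInwardUnitNormal.norm_eq {c : EuclideanSpace ℝ (Fin n) → ℝ}
    {y ν : EuclideanSpace ℝ (Fin n)} (hy : 0 < c y)
    (h : IsInwardUnitNormal M (isotropicMetric c) y ν) : ‖ν‖ = c y := by
  have h1 := h.1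
  rw [metricInner_isotropicMetric, real_inner_self_eq_norm_sq,
    inv_mul_eq_one₀ (by positivity)] at h1
  exact ((pow_left_inj₀ hy.le (norm_nonneg _) two_ne_zero).1 h1).symm

/-- The combination `dρ(w) ν - dρ(ν) w` is tangent to the boundary, hence orthogonal to `ν`. Thus
`dρ` is a multiple of the inner product with `ν`. -/
theorem fderiv_mul_inner_self_of_normal {c ρ : EuclideanSpace ℝ (Fin n) → ℝ}
    {y ν : EuclideanSpace ℝ (Fin n)} (hy : 0 < c y)
    (h : ∀ w, fderiv ℝ ρ y w = 0 → metricInner (isotropicMetric c) y ν w = 0)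
    (w : EuclideanSpace ℝ (Fin n)) :
    fderiv ℝ ρ y w * inner ℝ ν ν = fderiv ℝ ρ y ν * inner ℝ ν w := by
  have h1 := h (fderiv ℝ ρ y w • ν - fderiv ℝ ρ y ν • w)
    (by simp only [map_sub, map_smul, smul_eq_mul]; ring)
  rw [metricInner_isotropicMetric, inner_sub_right, inner_smul_right, inner_smul_right] at h1
  have := (mul_eq_zero.1 h1).resolve_left (by positivity)
  linarith

/-- The two normals may come from different defining functions. Having equal length, distinct `ν`
and `ν'` make `ν - ν'` strictly inward for `ρ` and strictly outward for `ρ'`; but a direction that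
enters `M` cannot be outward. -/
theorem IsInwardUnitNormal.unique {c : EuclideanSpace ℝ (Fin n) → ℝ}
    {y ν ν' : EuclideanSpace ℝ (Fin n)} (hy : 0 < c y)
    (h : IsInwardUnitNormal M (isotropicMetric c) y ν)
    (h' : IsInwardUnitNormal M (isotropicMetric c) y ν') : ν = ν' := by
  have hn := h.norm_eq hy
  have hn' := h'.norm_eq hy
  obtain ⟨-, U, ρ, hρ, hpos, hker⟩ := h
  obtain ⟨-, U', ρ', hρ', hpos', hker'⟩ := h'
  by_contra hne
  have hνν : inner ℝ ν ν = c y ^ 2 := by rw [real_inner_self_eq_norm_sq, hn]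
  have hνν' : inner ℝ ν' ν' = c y ^ 2 := by rw [real_inner_self_eq_norm_sq, hn']
  have hlt : 0 < c y ^ 2 - inner ℝ ν ν' := by
    have h1 : 0 < ‖ν - ν'‖ ^ 2 := by
      have := norm_pos_iff.2 (sub_ne_zero.2 hne)
      positivity
    rw [norm_sub_sq_real, hn, hn'] at h1
    linarith
  have e := fderiv_mul_inner_self_of_normal hy hker (ν - ν')
  have e' := fderiv_mul_inner_self_of_normal hy hker' (ν - ν')
  rw [inner_sub_right, hνν] at e
  rw [inner_sub_right, hνν', real_inner_comm] at e'
  have hc2 : 0 < c y ^ 2 := by positivity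
  have p1 : 0 < fderiv ℝ ρ y (ν - ν') := by
    have := mul_pos hpos hlt
    rw [← e] at this
    exact pos_of_mul_pos_left this hc2.le
  have p2 := hρ'.fderiv_nonneg (hρ.eventually_mem p1)
  nlinarith [mul_pos hpos' hlt, mul_nonneg p2 hc2.le]

/-! ### Geodesics of isotropic metrics -/

/-- `γ` is a curve in `M` on `[0, s]` with velocity `v`, and it solves the geodesic equation of
`c⁻² dx²`. -/
structure IsIsotropicGeodesic (M : Set (EuclideanSpace ℝ (Fin n)))
    (c : EuclideanSpace ℝ (Fin n) → ℝ) (s : ℝ) (γ v : ℝ → EuclideanSpace ℝ (Fin n)) : Prop where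
  mapsTo : MapsTo γ (Icc 0 s) M
  hasDerivWithinAt : ∀ t ∈ Icc 0 s, HasDerivWithinAt γ (v t) (Icc 0 s) t
  hasDerivWithinAt_velocity : ∀ t ∈ Icc 0 s, HasDerivWithinAt v
    (acceleration (c (γ t)) (fderivWithin ℝ (fun z => (c z ^ 2)⁻¹) M (γ t)) (v t)) (Icc 0 s) t

theorem IsNormalGeodesic.exists_velocity {c : EuclideanSpace ℝ (Fin n) → ℝ}
    (hpos : ∀ x ∈ M, 0 < c x) {y : EuclideanSpace ℝ (Fin n)} {s : ℝ}
    {γ : ℝ → EuclideanSpace ℝ (Fin n)} (h : IsNormalGeodesic M (isotropicMetric c) y s γ) :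
    ∃ v, IsIsotropicGeodesic M c s γ v ∧ IsInwardUnitNormal M (isotropicMetric c) y (v 0) := by
  obtain ⟨-, hm, v, hv, hode⟩ := h
  refine ⟨v, ⟨hm, fun t ht => (hode t ht).1, fun t ht => ?_⟩, hv⟩
  rw [← geodesic_acceleration_isotropicMetric M (hpos _ (hm ht)).ne']
  exact (hode t ht).2

theorem IsNormalGeodesic.mono {g : EuclideanSpace ℝ (Fin n) → Matrix (Fin n) (Fin n) ℝ}
    {y : EuclideanSpace ℝ (Fin n)} {s t : ℝ} {γ : ℝ → EuclideanSpace ℝ (Fin n)}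
    (h : IsNormalGeodesic M g y s γ) (hts : t ≤ s) : IsNormalGeodesic M g y t γ := by
  have hsub : Icc 0 t ⊆ Icc 0 s := Icc_subset_Icc_right hts
  obtain ⟨h0, hm, v, hv, hode⟩ := h
  exact ⟨h0, hm.mono_left hsub, v, hv, fun u hu =>
    ⟨(hode u (hsub hu)).1.mono hsub, (hode u (hsub hu)).2.mono hsub⟩⟩

theorem inner_acceleration (r : ℝ) (D : EuclideanSpace ℝ (Fin n) →L[ℝ] ℝ)
    (v : EuclideanSpace ℝ (Fin n)) :
    inner ℝ v (acceleration r D v) = -(r ^ 2 / 2) * (D v * ‖v‖ ^ 2) := by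
  rw [acceleration, inner_smul_right, inner_sub_right, inner_smul_right, inner_smul_right,
    real_inner_self_eq_norm_sq, real_inner_comm, InnerProductSpace.toDual_symm_apply]
  ring

theorem SmoothOn.differentiableOn_inv_sq {c : EuclideanSpace ℝ (Fin n) → ℝ}
    (hc : SmoothOn M c) (hpos : ∀ x ∈ M, 0 < c x) :
    DifferentiableOn ℝ (fun z => (c z ^ 2)⁻¹) M := by
  obtain ⟨F, hF, hcF⟩ := hc
  have hd : DifferentiableOn ℝ c M :=
    ((hF.differentiable (by simp)).differentiableOn).congr hcF
  exact (hd.pow 2).inv fun x hx => ne_of_gt (pow_pos (hpos x hx) 2)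

/-- The speed of a geodesic is conserved. -/
theorem IsIsotropicGeodesic.speed_eq {c : EuclideanSpace ℝ (Fin n) → ℝ}
    (hc : SmoothOn M c) (hpos : ∀ x ∈ M, 0 < c x) {s : ℝ}
    {γ v : ℝ → EuclideanSpace ℝ (Fin n)} (h : IsIsotropicGeodesic M c s γ v)
    (h0 : ‖v 0‖ = c (γ 0)) {t : ℝ} (ht : t ∈ Icc 0 s) : ‖v t‖ = c (γ t) := by
  have hd : ∀ t ∈ Icc 0 s,
      HasDerivWithinAt (fun t => (c (γ t) ^ 2)⁻¹ * ‖v t‖ ^ 2) 0 (Icc 0 s) t := by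
    intro t ht
    have hct := (hpos _ (h.mapsTo ht)).ne'
    have h1 := (((hc.differentiableOn_inv_sq hpos) _ (h.mapsTo ht)).hasFDerivWithinAt
      ).comp_hasDerivWithinAt t (h.hasDerivWithinAt t ht) h.mapsTo
    have h2 := (h.hasDerivWithinAt_velocity t ht).norm_sq
    -- The term from differentiating `c⁻²` along the curve cancels the one from `2 ⟨v, v'⟩`.
    refine (h1.mul h2).congr_deriv ?_
    rw [inner_acceleration]
    simp only [Function.comp_apply]
    field_simp
    ring
  have hconst := constant_of_derivWithin_zero (fun t ht => (hd t ht).differentiableWithinAt)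
    (fun t ht' => (hd t (Ico_subset_Icc_self ht')).derivWithin
      (uniqueDiffOn_Icc (ht'.1.trans_lt ht'.2) t (Ico_subset_Icc_self ht'))) t ht
  have hp := hpos _ (h.mapsTo ht)
  have hp0 := hpos _ (h.mapsTo ⟨le_rfl, ht.1.trans ht.2⟩)
  simp only [h0] at hconst
  rw [inv_mul_cancel₀ (by positivity), inv_mul_eq_one₀ (by positivity)] at hconst
  exact ((pow_left_inj₀ hp.le (norm_nonneg _) two_ne_zero).1 hconst).symm

/-- Compactness takes the place of convexity: local Lipschitz bounds on a compact set yield a global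
one. -/
theorem exists_lipschitzOnWith_of_contDiffAt {E F : Type*} [NormedAddCommGroup E]
    [NormedSpace ℝ E] [NormedAddCommGroup F] [NormedSpace ℝ F] {f : E → F} {K : Set E}
    (hK : IsCompact K) (hf : ∀ x ∈ K, ContDiffAt ℝ 1 f x) : ∃ C, LipschitzOnWith C f K := by
  refine LocallyLipschitzOn.exists_lipschitzOnWith_of_compact hK fun x hx => ?_
  obtain ⟨C, t, ht, hC⟩ := (hf x hx).exists_lipschitzOnWith
  exact ⟨C, t, mem_nhdsWithin_of_mem_nhds ht, hC⟩

theorem SmoothOn.exists_lipschitzOnWith {f : EuclideanSpace ℝ (Fin n) → ℝ} (hM : IsCompact M)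
    (hf : SmoothOn M f) : ∃ C, LipschitzOnWith C f M := by
  obtain ⟨F, hF, hfF⟩ := hf
  obtain ⟨C, hC⟩ := exists_lipschitzOnWith_of_contDiffAt hM
    fun x _ => hF.contDiffAt.of_le (by simp)
  refine ⟨C, fun x hx z hz => ?_⟩
  rw [hfF hx, hfF hz]
  exact hC hx hz

/-- The geodesic vector field is Lipschitz for bounded velocities. -/
theorem exists_lipschitzOnWith_geodesicField (hM : IsSmoothCompactDomain M)
    {c : EuclideanSpace ℝ (Fin n) → ℝ} (hc : SmoothOn M c) (hpos : ∀ x ∈ M, 0 < c x) (B : ℝ) :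
    ∃ C, LipschitzOnWith C
      (fun p : EuclideanSpace ℝ (Fin n) × EuclideanSpace ℝ (Fin n) =>
        (p.2, acceleration (c p.1) (fderivWithin ℝ (fun z => (c z ^ 2)⁻¹) M p.1) p.2))
      (M ×ˢ Metric.closedBall 0 B) := by
  obtain ⟨F, hF, hcF⟩ := hc
  have hinv : ∀ x ∈ M, ContDiffAt ℝ ∞ (fun z => (F z ^ 2)⁻¹) x := fun x hx =>
    (hF.contDiffAt.pow 2).inv (by rw [← hcF hx]; exact (pow_pos (hpos x hx) 2).ne')
  -- Unique differentiability of `M` lets the one-sided derivative be replaced by that of the smooth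
  -- extension `F`.
  have hfd : ∀ x ∈ M, fderivWithin ℝ (fun z => (c z ^ 2)⁻¹) M x =
      fderiv ℝ (fun z => (F z ^ 2)⁻¹) x := by
    intro x hx
    rw [fderivWithin_congr (f := fun z => (F z ^ 2)⁻¹) (fun z hz => by simp only [hcF hz])
      (by simp only [hcF hx])]
    exact ((hinv x hx).differentiableAt (by simp)).fderivWithin (hM.uniqueDiffOn x hx)
  obtain ⟨C, hC⟩ := exists_lipschitzOnWith_of_contDiffAt
    (f := fun p : EuclideanSpace ℝ (Fin n) × EuclideanSpace ℝ (Fin n) =>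
      (p.2, acceleration (F p.1) (fderiv ℝ (fun z => (F z ^ 2)⁻¹) p.1) p.2))
    (hM.isCompact.prod (isCompact_closedBall (0 : EuclideanSpace ℝ (Fin n)) B)) (by
      rintro ⟨x, v⟩ ⟨hx, -⟩
      have hD : ContDiffAt ℝ 1 (fun p : EuclideanSpace ℝ (Fin n) × EuclideanSpace ℝ (Fin n) =>
          fderiv ℝ (fun z => (F z ^ 2)⁻¹) p.1) (x, v) :=
        ContDiffAt.comp (x, v) ((hinv x hx).fderiv_right (m := 1) (WithTop.coe_le_coe.2 le_top))
          contDiffAt_fst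
      have hF1 : ContDiffAt ℝ 1 (fun p : EuclideanSpace ℝ (Fin n) × EuclideanSpace ℝ (Fin n) =>
          F p.1) (x, v) :=
        ContDiffAt.comp (x, v) (hF.contDiffAt.of_le (by simp)) contDiffAt_fst
      have hG : ContDiffAt ℝ 1 (fun p : EuclideanSpace ℝ (Fin n) × EuclideanSpace ℝ (Fin n) =>
          (InnerProductSpace.toDual ℝ (EuclideanSpace ℝ (Fin n))).symm
            (fderiv ℝ (fun z => (F z ^ 2)⁻¹) p.1)) (x, v) :=
        ((InnerProductSpace.toDual ℝ (EuclideanSpace ℝ (Fin n))).symm.toContinuousLinearEquiv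
          |>.contDiff.contDiffAt).comp (x, v) hD
      refine contDiffAt_snd.prodMk ?_
      exact ((hF1.pow 2).div_const 2).smul ((((contDiff_norm_sq ℝ).contDiffAt.comp (x, v)
        contDiffAt_snd).smul hG).sub ((contDiffAt_const.mul
          (hD.clm_apply contDiffAt_snd)).smul contDiffAt_snd)))
  refine ⟨C, fun p hp q hq => ?_⟩
  simp only [hfd _ hp.1, hfd _ hq.1, hcF hp.1, hcF hq.1]
  exact hC hp hq

/-- Continuous velocities on a compact interval are bounded, so both phase curves `(γ, v)` stay
where the geodesic field is Lipschitz, and ODE uniqueness applies. -/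
theorem IsIsotropicGeodesic.eqOn (hM : IsSmoothCompactDomain M)
    {c : EuclideanSpace ℝ (Fin n) → ℝ} (hc : SmoothOn M c) (hpos : ∀ x ∈ M, 0 < c x) {s : ℝ}
    {γ v γ' v' : ℝ → EuclideanSpace ℝ (Fin n)} (h : IsIsotropicGeodesic M c s γ v)
    (h' : IsIsotropicGeodesic M c s γ' v') (h0 : γ 0 = γ' 0) (hv0 : v 0 = v' 0) :
    EqOn γ γ' (Icc 0 s) := by
  have hcv : ContinuousOn v (Icc 0 s) :=
    fun t ht => (h.hasDerivWithinAt_velocity t ht).continuousWithinAt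
  have hcv' : ContinuousOn v' (Icc 0 s) :=
    fun t ht => (h'.hasDerivWithinAt_velocity t ht).continuousWithinAt
  obtain ⟨B, hB⟩ := isCompact_Icc.exists_bound_of_continuousOn hcv
  obtain ⟨B', hB'⟩ := isCompact_Icc.exists_bound_of_continuousOn hcv'
  obtain ⟨C, hC⟩ := exists_lipschitzOnWith_geodesicField hM hc hpos (max B B')
  have hder : ∀ {γ v : ℝ → EuclideanSpace ℝ (Fin n)}, IsIsotropicGeodesic M c s γ v →
      ∀ t ∈ Icc 0 s, HasDerivWithinAt (fun t => (γ t, v t)) (v t, acceleration (c (γ t))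
        (fderivWithin ℝ (fun z => (c z ^ 2)⁻¹) M (γ t)) (v t)) (Icc 0 s) t :=
    fun h t ht => (h.hasDerivWithinAt t ht).prodMk (h.hasDerivWithinAt_velocity t ht)
  have hIci : ∀ t ∈ Ico 0 s, Icc 0 s ∈ 𝓝[≥] t := fun t ht =>
    mem_of_superset (Icc_mem_nhdsGE ht.2) (Icc_subset_Icc_left ht.1)
  have := ODE_solution_unique_of_mem_Icc_right (fun _ _ => hC)
    (fun t ht => (hder h t ht).continuousWithinAt)
    (fun t ht => (hder h t (Ico_subset_Icc_self ht)).mono_of_mem_nhdsWithin (hIci t ht))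
    (fun t ht => ⟨h.mapsTo (Ico_subset_Icc_self ht), by
      simpa using Or.inl (hB t (Ico_subset_Icc_self ht))⟩)
    (fun t ht => (hder h' t ht).continuousWithinAt)
    (fun t ht => (hder h' t (Ico_subset_Icc_self ht)).mono_of_mem_nhdsWithin (hIci t ht))
    (fun t ht => ⟨h'.mapsTo (Ico_subset_Icc_self ht), by
      simpa using Or.inr (hB' t (Ico_subset_Icc_self ht))⟩)
    (by rw [h0, hv0])
  exact fun t ht => congrArg Prod.fst (this ht)

/-! ### The coordinate map along a normal geodesic -/

/-- `Phi` chooses a geodesic separately for each time; uniqueness makes all the choices agree with a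
single curve. -/
theorem IsNormalGeodesic.Phi_eq (hM : IsSmoothCompactDomain M)
    {c : EuclideanSpace ℝ (Fin n) → ℝ} (hc : SmoothOn M c) (hpos : ∀ x ∈ M, 0 < c x)
    {y : EuclideanSpace ℝ (Fin n)} {s : ℝ} {γ : ℝ → EuclideanSpace ℝ (Fin n)}
    (h : IsNormalGeodesic M (isotropicMetric c) y s γ) {t : ℝ} (ht : t ∈ Icc 0 s) :
    Phi M (isotropicMetric c) (y, t) = γ t := by
  have hex : ∃ γ, IsNormalGeodesic M (isotropicMetric c) (y, t).1 (y, t).2 γ :=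
    ⟨γ, h.mono ht.2⟩
  rw [Phi, dif_pos hex]
  have h1 : IsNormalGeodesic M (isotropicMetric c) y t hex.choose := hex.choose_spec
  have h2 := h.mono ht.2
  obtain ⟨v, hv, hv0⟩ := h1.exists_velocity hpos
  obtain ⟨w, hw, hw0⟩ := h2.exists_velocity hpos
  have hy : y ∈ M := h.1 ▸ h.2.1 ⟨le_rfl, ht.1.trans ht.2⟩
  exact hv.eqOn hM hc hpos hw (h1.1.trans h2.1.symm) (hv0.unique (hpos y hy) hw0) ⟨ht.1, le_rfl⟩

/-- Since `sigma` is a supremum, lying strictly below it gives a geodesic that continues beyond `s`.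
This room is what allows differentiation at `s`. -/
theorem exists_isNormalGeodesic_of_mem_semiGeodesicDomain
    {g : EuclideanSpace ℝ (Fin n) → Matrix (Fin n) (Fin n) ℝ}
    {Γ : Set (EuclideanSpace ℝ (Fin n))} {y : EuclideanSpace ℝ (Fin n)} {s : ℝ}
    (h : (y, s) ∈ semiGeodesicDomain M g Γ) : ∃ s', s < s' ∧ ∃ γ, IsNormalGeodesic M g y s' γ := by
  obtain ⟨-, hs, hlt⟩ := h
  obtain ⟨_, ⟨s', hs', rfl, γ, hγ, -⟩, hlt'⟩ := lt_sSup_iff.1 hlt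
  exact ⟨s', (ENNReal.ofReal_lt_ofReal_iff hs').1 hlt', γ, hγ⟩

/-- In semi-geodesic coordinates `(y, s)` the point `Φ(y, s)` of `M` moves with Euclidean speed
`c` when `s` varies. -/
theorem exists_hasDerivWithinAt_Phi (hM : IsSmoothCompactDomain M)
    {Γ Ω : Set (EuclideanSpace ℝ (Fin n))} {r₀ : ℝ} {c : EuclideanSpace ℝ (Fin n) → ℝ}
    (hc : c ∈ admissibleSpeeds M Γ Ω r₀) {y : EuclideanSpace ℝ (Fin n)} (hy : y ∈ Γ) {s : ℝ}
    (hs : s ∈ Ico 0 r₀) :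
    Phi M (isotropicMetric c) (y, s) ∈ M ∧
      ∃ w, ‖w‖ = c (Phi M (isotropicMetric c) (y, s)) ∧
        HasDerivWithinAt (fun t => Phi M (isotropicMetric c) (y, t)) w (Ico 0 r₀) s := by
  obtain ⟨hsm, hpos, hdom, -⟩ := hc
  obtain ⟨s', hs', γ, hγ⟩ := exists_isNormalGeodesic_of_mem_semiGeodesicDomain
    (hdom (mk_mem_prod hy hs))
  have hΦ : ∀ t ∈ Icc 0 s', Phi M (isotropicMetric c) (y, t) = γ t :=
    fun t ht => hγ.Phi_eq hM hsm hpos ht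
  have hss : s ∈ Icc 0 s' := ⟨hs.1, hs'.le⟩
  have hyM : y ∈ M := hγ.1 ▸ hγ.2.1 ⟨le_rfl, hs.1.trans hs'.le⟩
  obtain ⟨v, hv, hv0⟩ := hγ.exists_velocity hpos
  rw [hΦ s hss]
  refine ⟨hv.mapsTo hss, v s, hv.speed_eq hsm hpos ?_ hss, ?_⟩
  · rw [hγ.1]
    exact hv0.norm_eq (hpos y hyM)
  · refine ((hv.hasDerivWithinAt s hss).congr hΦ (hΦ s hss)).mono_of_mem_nhdsWithin ?_
    filter_upwards [self_mem_nhdsWithin, mem_nhdsWithin_of_mem_nhds (Iio_mem_nhds hs')]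
      with t ht hlt
    exact ⟨ht.1, le_of_lt hlt⟩

/-! ### Linear test functions -/

theorem harmonicOnNhd_clm (L : EuclideanSpace ℝ (Fin n) →L[ℝ] ℝ)
    (s : Set (EuclideanSpace ℝ (Fin n))) : InnerProductSpace.HarmonicOnNhd L s := by
  intro x _
  refine ⟨L.contDiff.contDiffAt, Eventually.of_forall fun z => ?_⟩
  rw [InnerProductSpace.laplacian_eq_iteratedFDeriv_stdOrthonormalBasis]
  have h : fderiv ℝ L = fun _ => L := funext fun z => L.fderiv
  simp [iteratedFDeriv_two_apply, h]

theorem c1Norm_clm_le (L : EuclideanSpace ℝ (Fin n) →L[ℝ] ℝ) {R : ℝ}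
    (hR : ∀ x ∈ M, ‖x‖ ≤ R) (hL : ‖L‖ * (R + 1) ≤ 1) (hR0 : 0 ≤ R) : c1Norm M L ≤ 1 := by
  have h1 : supNorm M L ≤ ENNReal.ofReal (‖L‖ * R) := by
    refine iSup₂_le fun x hx => ?_
    rw [← ofReal_norm]
    exact ENNReal.ofReal_le_ofReal ((L.le_opNorm x).trans (by gcongr; exact hR x hx))
  have h2 : ⨆ p ∈ M, diffNorm M L p ≤ ENNReal.ofReal ‖L‖ := by
    refine iSup₂_le fun x hx => ?_
    rw [ofReal_norm]
    exact iInf₂_le L L.hasFDerivWithinAt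
  refine (add_le_add h1 h2).trans ?_
  rw [← ENNReal.ofReal_add (by positivity) (by positivity)]
  exact ENNReal.ofReal_le_one.2 (by linarith)

/-- A vector is bounded by the values on it of the functionals of norm at most `κ`. -/
theorem mul_norm_le_of_forall_clm {κ N : ℝ} (hκ : 0 ≤ κ) {d : EuclideanSpace ℝ (Fin n)}
    (h : ∀ L : EuclideanSpace ℝ (Fin n) →L[ℝ] ℝ, ‖L‖ ≤ κ → |L d| ≤ N) : κ * ‖d‖ ≤ N := by
  obtain ⟨L, hL, hLd⟩ := exists_dual_vector'' ℝ d
  have h1 := h (κ • L) (by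
    rw [norm_smul, Real.norm_of_nonneg hκ]
    exact mul_le_of_le_one_right hκ hL)
  rw [smul_apply, hLd] at h1
  simpa [abs_mul, abs_of_nonneg hκ] using h1

/-- The derivative in the second variable is bounded by the norm of the differential. -/
theorem enorm_le_diffNorm_prod {X : Type*} [NormedAddCommGroup X] [NormedSpace ℝ X] {Γ : Set X}
    {r₀ : ℝ} {f : X × ℝ → ℝ} {y : X} (hy : y ∈ Γ) {s a : ℝ} (hs : s ∈ Ico 0 r₀)
    (hf : HasDerivWithinAt (fun t => f (y, t)) a (Ico 0 r₀) s) :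
    ‖a‖ₑ ≤ diffNorm (Γ ×ˢ Ico 0 r₀) f (y, s) := by
  -- Every candidate derivative `L` satisfies `L (0, 1) = a`, because derivatives within the
  -- interval are unique; and `(0, 1)` has norm one.
  refine le_iInf₂ fun L hL => ?_
  have hcurve : HasDerivWithinAt (fun t : ℝ => (y, t)) ((0 : X), (1 : ℝ)) (Ico 0 r₀) s :=
    (hasDerivWithinAt_const s _ y).prodMk (hasDerivWithinAt_id s _)
  have h1 := HasFDerivWithinAt.comp_hasDerivWithinAt (t := Γ ×ˢ Ico 0 r₀)
    (f := fun t : ℝ => (y, t)) s hL hcurve fun t ht => mk_mem_prod hy ht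
  have huniq : UniqueDiffWithinAt ℝ (Ico 0 r₀) s :=
    uniqueDiffOn_Ico 0 r₀ s hs
  have ha : a = L (0, 1) := huniq.eq_deriv _ hf h1
  rw [ha]
  refine enorm_le_iff_norm_le.2 ((L.le_opNorm _).trans ?_)
  simp [Prod.norm_def]

/-- Differences of the maps `Φ` and of their derivatives along geodesics are bounded by the
operator norm of the difference of the operators `H`. -/
theorem mul_norm_sub_le_opNorm
    {Γ : Set (EuclideanSpace ℝ (Fin n))} {r₀ R : ℝ} (hR0 : 0 ≤ R) (hR : ∀ x ∈ M, ‖x‖ ≤ R)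
    {c c' : EuclideanSpace ℝ (Fin n) → ℝ}
    (hN : opNorm M (Γ ×ˢ Ico 0 r₀) (fun φ => H M c' φ - H M c φ) ≠ ⊤)
    {y w w' : EuclideanSpace ℝ (Fin n)} (hy : y ∈ Γ) {s : ℝ} (hs : s ∈ Ico 0 r₀)
    (hw : HasDerivWithinAt (fun t => Phi M (isotropicMetric c) (y, t)) w (Ico 0 r₀) s)
    (hw' : HasDerivWithinAt (fun t => Phi M (isotropicMetric c') (y, t)) w' (Ico 0 r₀) s) :
    (R + 1)⁻¹ * ‖Phi M (isotropicMetric c') (y, s) - Phi M (isotropicMetric c) (y, s)‖ ≤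
        (opNorm M (Γ ×ˢ Ico 0 r₀) (fun φ => H M c' φ - H M c φ)).toReal ∧
      (R + 1)⁻¹ * ‖w' - w‖ ≤
        (opNorm M (Γ ×ˢ Ico 0 r₀) (fun φ => H M c' φ - H M c φ)).toReal := by
  set N := opNorm M (Γ ×ˢ Ico 0 r₀) (fun φ => H M c' φ - H M c φ) with hNdef
  have key : ∀ L : EuclideanSpace ℝ (Fin n) →L[ℝ] ℝ, ‖L‖ ≤ (R + 1)⁻¹ →
      c1Norm (Γ ×ˢ Ico 0 r₀) (H M c' L - H M c L) ≤ N := by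
    intro L hL
    refine le_iSup₂_of_le (f := fun (φ : EuclideanSpace ℝ (Fin n) → ℝ)
      (_ : φ ∈ {φ ∈ harmonicFunctions M | c1Norm M φ ≤ 1}) =>
        c1Norm (Γ ×ˢ Ico 0 r₀) (H M c' φ - H M c φ)) (L : EuclideanSpace ℝ (Fin n) → ℝ)
      ⟨⟨⟨L, L.contDiff, fun _ _ => rfl⟩, harmonicOnNhd_clm L _⟩, ?_⟩ le_rfl
    refine c1Norm_clm_le L hR ?_ hR0
    rw [← le_div_iff₀ (by positivity), one_div]
    exact hL
  have abs_le : ∀ a : ℝ, ‖a‖ₑ ≤ N → |a| ≤ N.toReal := by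
    intro a ha
    have := ENNReal.toReal_mono hN ha
    simpa using this
  have hp : (y, s) ∈ Γ ×ˢ Ico 0 r₀ := mk_mem_prod hy hs
  refine ⟨mul_norm_le_of_forall_clm (by positivity) fun L hL => abs_le _ ?_,
    mul_norm_le_of_forall_clm (by positivity) fun L hL => abs_le _ ?_⟩
  · refine le_trans ?_ (le_self_add.trans (key L hL))
    refine le_iSup₂_of_le (f := fun p (_ : p ∈ Γ ×ˢ Ico 0 r₀) => ‖(H M c' L - H M c L) p‖ₑ)
      (y, s) hp ?_
    simp [H]
  · refine le_trans ?_ (le_add_self.trans (key L hL))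
    refine le_iSup₂_of_le (f := fun p (_ : p ∈ Γ ×ˢ Ico 0 r₀) =>
      diffNorm (Γ ×ˢ Ico 0 r₀) (H M c' L - H M c L) p) (y, s) hp ?_
    refine enorm_le_diffNorm_prod hy hs ?_
    rw [map_sub]
    exact (L.hasFDerivAt.comp_hasDerivWithinAt s hw').sub
      (L.hasFDerivAt.comp_hasDerivWithinAt s hw)

/-! ### The stability estimate -/

theorem abs_le_of_c2Norm_le {f : EuclideanSpace ℝ (Fin n) → ℝ} {ε : ℝ} (hε : 0 ≤ ε)
    (h : c2Norm M f ≤ ENNReal.ofReal ε) {x : EuclideanSpace ℝ (Fin n)} (hx : x ∈ M) :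
    |f x| ≤ ε := by
  have h1 : ‖f x‖ₑ ≤ c2Norm M f := by
    refine le_trans ?_ (Finset.single_le_sum (f := fun j =>
      ⨆ x ∈ M, ‖iteratedFDerivWithin ℝ j f M x‖ₑ) (fun _ _ => zero_le)
      (Finset.mem_range.2 (by norm_num : 0 < 3)))
    refine le_iSup₂_of_le (f := fun x (_ : x ∈ M) => ‖iteratedFDerivWithin ℝ 0 f M x‖ₑ) x hx ?_
    exact enorm_le_iff_norm_le.2 norm_iteratedFDerivWithin_zero.ge
  have h2 := h1.trans h
  rw [← ofReal_norm, ENNReal.ofReal_le_ofReal_iff hε] at h2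
  exact h2

end SemiGeodesic

theorem mainTheorem1 {n : ℕ} (M : Set (EuclideanSpace ℝ (Fin n)))
    (hM : SemiGeodesic.IsSmoothCompactDomain M)
    (Γ : Set (EuclideanSpace ℝ (Fin n)))
    (hΓ : ∃ V : Set (EuclideanSpace ℝ (Fin n)), IsOpen V ∧ Γ = V ∩ frontier M)
    (r₀ : ℝ) (hr₀ : 0 < r₀)
    (Ω : Set (EuclideanSpace ℝ (Fin n))) (hΩ : Ω ⊆ M)
    (G : Set (EuclideanSpace ℝ (Fin n) → ℝ))
    (hG : G ⊆ SemiGeodesic.admissibleSpeeds M Γ Ω r₀)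
    (c : EuclideanSpace ℝ (Fin n) → ℝ) (hc : c ∈ G) :
    ∃ ε : ℝ, 0 < ε ∧ ∃ C : ℝ, 0 < C ∧ ∀ c' ∈ G,
      SemiGeodesic.c2Norm M (fun x => c' x - c x) ≤ ENNReal.ofReal ε →
      SemiGeodesic.supNorm Ω (fun x => c' x ^ 2 - c x ^ 2) ≤
        ENNReal.ofReal C *
          SemiGeodesic.opNorm M (Γ ×ˢ Set.Ico 0 r₀)
            (fun φ => SemiGeodesic.H M c' φ - SemiGeodesic.H M c φ) := by
  obtain ⟨R, hR0, hR⟩ : ∃ R : ℝ, 0 < R ∧ ∀ x ∈ M, ‖x‖ ≤ R :=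
    hM.isCompact.isBounded.exists_pos_norm_le
  obtain ⟨K, hK⟩ := (hG hc).1.exists_lipschitzOnWith hM.isCompact
  obtain ⟨B, hB⟩ := hM.isCompact.exists_bound_of_continuousOn hK.continuousOn
  have hB0 : 0 ≤ B := by
    obtain ⟨x, hx⟩ := hM.isConnected.nonempty
    exact (norm_nonneg _).trans (hB x hx)
  -- Closeness serves only to bound `c' + c` by `2 * B + 1`, so `ε = 1` suffices. The factor `R + 1`
  -- undoes the normalization of the linear test functions, and `1 + K` combines the speed
  -- difference with the Lipschitz bound.
  refine ⟨1, one_pos, (2 * B + 1) * ((1 + K) * (R + 1)), by positivity, fun c' hc' hclose => ?_⟩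
  set N := SemiGeodesic.opNorm M (Γ ×ˢ Set.Ico 0 r₀)
    (fun φ => SemiGeodesic.H M c' φ - SemiGeodesic.H M c φ) with hN
  by_cases hNtop : N = ⊤
  · rw [hNtop, ENNReal.mul_top (by simpa using by positivity)]
    exact le_top
  rw [← ENNReal.ofReal_toReal hNtop, ← ENNReal.ofReal_mul (by positivity)]
  refine iSup₂_le fun x hx => ?_
  rw [← ofReal_norm]
  refine ENNReal.ofReal_le_ofReal ?_
  -- Taking the coordinates of `x` with respect to `c'` leaves only the fixed speed `c` to be
  -- compared at two points, so the constant does not depend on `c'`.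
  obtain ⟨⟨y, s⟩, ⟨hy, hs⟩, hxy⟩ := (hG hc').2.2.2 (subset_closure hx)
  obtain ⟨hmem, w, hw, hdw⟩ := SemiGeodesic.exists_hasDerivWithinAt_Phi hM (hG hc) hy hs
  obtain ⟨-, w', hw', hdw'⟩ := SemiGeodesic.exists_hasDerivWithinAt_Phi hM (hG hc') hy hs
  obtain ⟨h1, h2⟩ := SemiGeodesic.mul_norm_sub_le_opNorm hR0.le hR hNtop hy hs hdw hdw'
  rw [← hN, inv_mul_le_iff₀ (by positivity)] at h1 h2
  rw [hxy] at hw' h1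
  have h3 : |c' x - c (SemiGeodesic.Phi M (SemiGeodesic.isotropicMetric c) (y, s))| ≤
      ‖w' - w‖ := by
    rw [← hw', ← hw]
    exact abs_norm_sub_norm_le w' w
  have h4 : |c (SemiGeodesic.Phi M (SemiGeodesic.isotropicMetric c) (y, s)) - c x| ≤
      K * ‖x - SemiGeodesic.Phi M (SemiGeodesic.isotropicMetric c) (y, s)‖ := by
    have := hK.dist_le_mul _ hmem x (hΩ hx)
    rwa [Real.dist_eq, dist_comm, dist_eq_norm] at this
  have h5 : |c' x - c x| ≤ (1 + K) * (R + 1) * N.toReal := by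
    calc |c' x - c x| ≤ ‖w' - w‖ +
          K * ‖x - SemiGeodesic.Phi M (SemiGeodesic.isotropicMetric c) (y, s)‖ :=
          (abs_sub_le _ _ _).trans (add_le_add h3 h4)
      _ ≤ (R + 1) * N.toReal + K * ((R + 1) * N.toReal) := by gcongr
      _ = (1 + K) * (R + 1) * N.toReal := by ring
  have h6 : |c' x - c x| ≤ 1 :=
    SemiGeodesic.abs_le_of_c2Norm_le zero_le_one hclose (hΩ hx)
  have h7 : |c x| ≤ B := hB x (hΩ hx)
  have h8 : |c' x + c x| ≤ 2 * B + 1 := by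
    rw [abs_le] at h6 h7 ⊢
    constructor <;> linarith
  calc ‖c' x ^ 2 - c x ^ 2‖ = |c' x + c x| * |c' x - c x| := by
        rw [Real.norm_eq_abs, sq_sub_sq, abs_mul]
    _ ≤ (2 * B + 1) * ((1 + K) * (R + 1) * N.toReal) := by gcongr
    _ = (2 * B + 1) * ((1 + K) * (R + 1)) * N.toReal := by ring
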